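/- Let $\mu$ be a probability measure on an arbitrary measurable space $(\mathsf E,\mathscr E)$ and let $P$ be a $\mu$-invariant Markov kernel on it. Write also $P$ for the associated bounded operator on the real Hilbert space $L^2(\mu)$, $(Pf)(x)=\int f(y)\,P(x,\mathrm dy)$, and $P^*$ for its adjoint. Let $L^2_0(\mu)=\{f\in L^2(\mu):\mu(f)=0\}$ and $\|f\|_{\mathrm{osc}}=\operatorname{ess\,sup}_\mu f-\operatorname{ess\,inf}_\mu f\in[0,\infty]$. For a bounded operator $T$ on $L^2(\mu)$ let $\mathcal E(T,f)=\langle(\mathrm{Id}-T)f,f\rangle$. - $T$ *satisfies a WPI* (weak Poincaré inequality) if there is a decreasing function $\alpha:(0,\infty)\to[0,\infty)$ such that $$\|f\|_2^2\le\alpha(r)\,\mathcal E(T,f)+r\,\|f\|_{\mathrm{osc}}^2\qquad\text{for all } r>0,\ f\in L^2_0(\mu).$$ - $T$ is *convergent* if there is a sequence $(\gamma(n))_{n\in\mathbb N}$ in $(0,\infty)$ with $\gamma(n)\to0$ such that $\|T^nf\|_2^2\le\gamma(n)\,\|f\|_{\mathrm{osc}}^2$ for all $n\in\mathbb N$ and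 all $f\in L^2_0(\mu)$ with $0<\|f\|_{\mathrm{osc}}<\infty$. Assume that $P$ has positive holding probabilities almost everywhere, that is, $\mu(\{x\in\mathsf E:P(x,\{x\})=0\})=0$ (where a set that is not measurable is given its outer measure). Then the following are equivalent: (a) $P$ satisfies a WPI; (b) $P^*P$ satisfies a WPI; (c) $P$ is convergent; (d) $PP^*$ satisfies a WPI; (e) $P^*$ is convergent. -/

import Mathlib

open MeasureTheory ProbabilityTheory Filter Topology
open scoped ENNReal

noncomputable section

namespace MarkovWPI

variable {E : Type*} [MeasurableSpace E]

/-- Jensen's inequality and invariance: `∫ |P f|² dμ ≤ ∫ |f|² dμ`. -/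
theorem lintegral_sq_kernel_le {μ : Measure E} {P : Kernel E E} [IsMarkovKernel P]
    (hP : P.Invariant μ) {f : E → ℝ} (hf : AEStronglyMeasurable f μ) :
    ∫⁻ x, ‖∫ y, f y ∂(P x)‖ₑ ^ (2 : ℝ) ∂μ ≤ ∫⁻ x, ‖f x‖ₑ ^ (2 : ℝ) ∂μ := by
  have hbind : μ.bind P = μ := hP
  have hfb : AEStronglyMeasurable f (μ.bind P) := by rw [hbind]; exact hf
  have h1 : ∀ᵐ x ∂μ, AEStronglyMeasurable f (P x) := by
    have h := Measure.ae_ae_of_ae_comp (hfb.ae_eq_mk)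
    filter_upwards [h] with x hx
    exact ⟨_, hfb.stronglyMeasurable_mk, hx⟩
  calc ∫⁻ x, ‖∫ y, f y ∂(P x)‖ₑ ^ (2 : ℝ) ∂μ
      ≤ ∫⁻ x, ∫⁻ y, ‖f y‖ₑ ^ (2 : ℝ) ∂(P x) ∂μ := by
        refine lintegral_mono_ae ?_
        filter_upwards [h1] with x hx
        have h2 : eLpNorm f 1 (P x) ≤ eLpNorm f 2 (P x) :=
          eLpNorm_le_eLpNorm_of_exponent_le (by norm_num) hx
        rw [eLpNorm_one_eq_lintegral_enorm,
          eLpNorm_eq_lintegral_rpow_enorm_toReal (by norm_num) (by norm_num)] at h2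
        have h3 := (enorm_integral_le_lintegral_enorm (μ := P x) f).trans h2
        have h4 := ENNReal.rpow_le_rpow h3 (by norm_num : (0 : ℝ) ≤ 2)
        rw [← ENNReal.rpow_mul] at h4
        simpa using h4
    _ = ∫⁻ x, ‖f x‖ₑ ^ (2 : ℝ) ∂(μ.bind P) := by
        rw [Measure.lintegral_bind P.measurable.aemeasurable (hfb.enorm.pow_const _)]
    _ = _ := by rw [hbind]

theorem memLp_kernel {μ : Measure E} {P : Kernel E E} [IsMarkovKernel P]
    (hP : P.Invariant μ) (f : Lp ℝ 2 μ) :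
    MemLp (fun x => ∫ y, f y ∂(P x)) 2 μ := by
  refine ⟨((Lp.stronglyMeasurable f).integral_kernel).aestronglyMeasurable, ?_⟩
  have hf := (Lp.memLp f).2
  rw [eLpNorm_lt_top_iff_lintegral_rpow_enorm_lt_top (by norm_num) (by norm_num)] at hf ⊢
  exact (lintegral_sq_kernel_le hP (Lp.aestronglyMeasurable f)).trans_lt hf

theorem ae_integrable_kernel {μ : Measure E} [IsProbabilityMeasure μ] {P : Kernel E E}
    [IsMarkovKernel P] (hP : P.Invariant μ) (f : Lp ℝ 2 μ) :
    ∀ᵐ x ∂μ, Integrable f (P x) := by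
  have hbind : μ.bind P = μ := hP
  have h : Integrable f (μ.bind P) := by
    rw [hbind]; exact (Lp.memLp f).integrable (by norm_num)
  exact Measure.ae_integrable_of_integrable_comp h

/-- The Markov operator on `L²(μ)` of a `μ`-invariant Markov kernel `P`:
`(P f)(x) = ∫ f(y) P(x, dy)` for `μ`-almost every `x`. -/
def markovOp (μ : Measure E) [IsProbabilityMeasure μ] (P : Kernel E E) [IsMarkovKernel P]
    (hP : P.Invariant μ) : Lp ℝ 2 μ →L[ℝ] Lp ℝ 2 μ :=
  LinearMap.mkContinuous
    { toFun := fun f => (memLp_kernel hP f).toLp _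
      map_add' := by
        intro f g
        rw [← MemLp.toLp_add]
        refine MemLp.toLp_congr _ _ ?_
        have hbind : μ.bind P = μ := hP
        have h : ∀ᵐ y ∂(μ.bind P), (f + g : Lp ℝ 2 μ) y = f y + g y := by
          rw [hbind]; exact Lp.coeFn_add f g
        filter_upwards [Measure.ae_ae_of_ae_comp h, ae_integrable_kernel hP f,
          ae_integrable_kernel hP g] with x hx hfx hgx
        rw [integral_congr_ae hx, integral_add hfx hgx]
        rfl
      map_smul' := by
        intro c f
        rw [RingHom.id_apply, ← MemLp.toLp_const_smul]
        refine MemLp.toLp_congr _ _ ?_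
        have hbind : μ.bind P = μ := hP
        have h : ∀ᵐ y ∂(μ.bind P), (c • f : Lp ℝ 2 μ) y = c * f y := by
          rw [hbind]; exact Lp.coeFn_smul c f
        filter_upwards [Measure.ae_ae_of_ae_comp h] with x hx
        rw [integral_congr_ae hx, integral_const_mul]
        rfl }
    1
    (by
      intro f
      rw [one_mul]
      change ‖(memLp_kernel hP f).toLp _‖ ≤ ‖f‖
      rw [Lp.norm_toLp, Lp.norm_def]
      refine ENNReal.toReal_mono (Lp.eLpNorm_ne_top f) ?_
      rw [eLpNorm_eq_lintegral_rpow_enorm_toReal (by norm_num) (by norm_num),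
        eLpNorm_eq_lintegral_rpow_enorm_toReal (by norm_num) (by norm_num)]
      exact ENNReal.rpow_le_rpow (lintegral_sq_kernel_le hP (Lp.aestronglyMeasurable f))
        (by norm_num))

theorem markovOp_apply_ae (μ : Measure E) [IsProbabilityMeasure μ] (P : Kernel E E)
    [IsMarkovKernel P] (hP : P.Invariant μ) (f : Lp ℝ 2 μ) :
    markovOp μ P hP f =ᵐ[μ] fun x => ∫ y, f y ∂(P x) :=
  (memLp_kernel hP f).coeFn_toLp

/-- `‖f‖_osc = ess sup f - ess inf f ∈ [0, ∞]`; the essential bounds are taken in the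
extended reals, so that the value is `∞` exactly when `f` is not essentially bounded. -/
def oscNorm {μ : Measure E} (f : Lp ℝ 2 μ) : ℝ≥0∞ :=
  (essSup (fun x => ((f x : ℝ) : EReal)) μ - essInf (fun x => ((f x : ℝ) : EReal)) μ).toENNReal

/-- The sieve `Ψ = ‖·‖²_osc`. -/
def oscSieve {μ : Measure E} (f : Lp ℝ 2 μ) : ℝ≥0∞ := oscNorm f ^ 2

/-- The Dirichlet form `ℰ(T, f) = ⟨(Id - T) f, f⟩`. -/
def dirichletForm {μ : Measure E} (T : Lp ℝ 2 μ →L[ℝ] Lp ℝ 2 μ) (f : Lp ℝ 2 μ) : ℝ :=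
  inner ℝ (f - T f) f

/-- `T` satisfies a weak Poincaré inequality for the sieve `Ψ`: there is a decreasing
`α : (0, ∞) → [0, ∞)` with `‖f‖² ≤ α(r) ℰ(T, f) + r Ψ(f)` for all `r > 0` and all mean-zero
`f` in `L²(μ)`. The inequality is void when `Ψ(f) = ∞`. -/
def SatisfiesWPI {μ : Measure E} (Ψ : Lp ℝ 2 μ → ℝ≥0∞) (T : Lp ℝ 2 μ →L[ℝ] Lp ℝ 2 μ) : Prop :=
  ∃ α : ℝ → ℝ, AntitoneOn α (Set.Ioi 0) ∧ (∀ r, 0 < r → 0 ≤ α r) ∧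
    ∀ r, 0 < r → ∀ f : Lp ℝ 2 μ, ∫ x, f x ∂μ = 0 → Ψ f ≠ ∞ →
      ‖f‖ ^ 2 ≤ α r * dirichletForm T f + r * (Ψ f).toReal

/-- `T` is `Ψ`-convergent: `‖Tⁿ f‖² ≤ γ(n) Ψ(f)` for all `n` and all mean-zero `f` in `L²(μ)`
with `0 < Ψ(f) < ∞`, for some positive sequence `γ` tending to zero. -/
def IsConvergent {μ : Measure E} (Ψ : Lp ℝ 2 μ → ℝ≥0∞) (T : Lp ℝ 2 μ →L[ℝ] Lp ℝ 2 μ) : Prop :=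
  ∃ γ : ℕ → ℝ, (∀ n, 0 < γ n) ∧ Tendsto γ atTop (𝓝 0) ∧
    ∀ n : ℕ, ∀ f : Lp ℝ 2 μ, ∫ x, f x ∂μ = 0 → 0 < Ψ f → Ψ f ≠ ∞ →
      ‖(T ^ n) f‖ ^ 2 ≤ γ n * (Ψ f).toReal

/-- Positive holding probabilities almost everywhere: `μ {x | P(x, {x}) = 0} = 0`. -/
def PositiveHolding (μ : Measure E) (P : Kernel E E) : Prop :=
  μ {x | P x {x} = 0} = 0

end MarkovWPI

end

/-! Three implications close the cycle for `P`, and only the first uses holding. From `P` to `P*P`: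
`2ℰ(P,f) = ℰ(P*P,f) + ‖f - Pf‖²`, so it suffices to bound `‖f - Pf‖²` by a multiple of `ℰ(P*P,f)`
plus a small multiple of `‖f‖²_osc`. For a stationary transition `(X, Y)`, `𝔼 (Pf(X) - f(Y))² = ‖f‖²
- ‖Pf‖² = ℰ(P*P,f)`, and on `{f(Y) = f(X)}` the integrand is `(Pf - f)²(X)`. That event contains
staying put, and `PositiveHolding.exists_uniform` bounds its conditional probability below,
uniformly in `f`, off a small set.

A WPI for `P*P` bounds `‖Pᵏf‖²` by its own decrement, and telescoping gives convergence. Conversely,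
`ℰ(Pⁿ,f) ≤ n² ℰ(P,f)` turns decay of `Pⁿ` into a WPI.

For `P*`, `ℰ(P*,f) = ℰ(P,f)`, and the second moment of `f(X) - P*f(Y)` plays the same role; no
reversed kernel is needed. -/

namespace MarkovWPI

/-! ### Contractions of a Hilbert space -/

section Hilbert

variable {H : Type*} [NormedAddCommGroup H] [InnerProductSpace ℝ H]

theorem norm_pow_apply_le {T : H →L[ℝ] H} (hT : ∀ f, ‖T f‖ ≤ ‖f‖) (n : ℕ) (f : H) :
    ‖(T ^ n) f‖ ≤ ‖f‖ := by
  induction n with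
  | zero => simp
  | succ k ih => rw [pow_succ', mul_apply_eq_comp]; exact (hT _).trans ih

/-- The gap between the two sides is `‖f‖² - ‖T f‖²`. -/
theorem norm_sub_apply_sq_le {T : H →L[ℝ] H} (hT : ∀ f, ‖T f‖ ≤ ‖f‖) (f : H) :
    ‖f - T f‖ ^ 2 ≤ 2 * inner ℝ (f - T f) f := by
  have h1 := norm_sub_sq_real f (T f)
  have h2 : ‖T f‖ ^ 2 ≤ ‖f‖ ^ 2 := pow_le_pow_left₀ (norm_nonneg _) (hT f) 2
  rw [inner_sub_left, real_inner_self_eq_norm_sq]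
  rw [real_inner_comm] at h1
  linarith

theorem norm_sub_pow_apply_le {T : H →L[ℝ] H} (hT : ∀ f, ‖T f‖ ≤ ‖f‖) (n : ℕ) (f : H) :
    ‖f - (T ^ n) f‖ ≤ n * ‖f - T f‖ := by
  induction n with
  | zero => simp
  | succ k ih =>
    have h : f - (T ^ (k + 1)) f = (f - (T ^ k) f) + (T ^ k) (f - T f) := by
      rw [pow_succ, mul_apply_eq_comp, map_sub]; abel
    rw [h]
    refine (norm_add_le _ _).trans ?_
    have := norm_pow_apply_le hT k (f - T f)
    rw [Nat.cast_succ]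
    linarith

variable [CompleteSpace H]

theorem norm_adjoint_apply_le {T : H →L[ℝ] H} (hT : ∀ f, ‖T f‖ ≤ ‖f‖) (f : H) :
    ‖ContinuousLinearMap.adjoint T f‖ ≤ ‖f‖ := by
  have h1 : ‖T‖ ≤ 1 := T.opNorm_le_bound zero_le_one (by simpa using hT)
  have h2 : ‖ContinuousLinearMap.adjoint T‖ = ‖T‖ := LinearIsometryEquiv.norm_map _ T
  exact (ContinuousLinearMap.le_of_opNorm_le _ (h2.trans_le h1) f).trans_eq (one_mul _)

theorem inner_adjoint_self (T : H →L[ℝ] H) (f : H) :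
    inner ℝ (ContinuousLinearMap.adjoint T f) f = inner ℝ (T f) f := by
  rw [ContinuousLinearMap.adjoint_inner_left, real_inner_comm]

/-- For a contraction, `ℰ(Tⁿ, f) ≤ n² ℰ(T, f)`. -/
theorem inner_sub_pow_apply_le {T : H →L[ℝ] H} (hT : ∀ f, ‖T f‖ ≤ ‖f‖) (n : ℕ) (f : H) :
    inner ℝ (f - (T ^ n) f) f ≤ (n : ℝ) ^ 2 * inner ℝ (f - T f) f := by
  induction n with
  | zero => simp
  | succ k ih =>
    set S := ContinuousLinearMap.adjoint T with hS
    have hSk : ContinuousLinearMap.adjoint (T ^ k) = S ^ k := by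
      rw [hS, ← ContinuousLinearMap.star_eq_adjoint, ← ContinuousLinearMap.star_eq_adjoint,
        star_pow]
    have hSf : inner ℝ (f - S f) f = inner ℝ (f - T f) f := by
      rw [inner_sub_left, inner_sub_left, hS, inner_adjoint_self]
    have h : f - (T ^ (k + 1)) f = (f - (T ^ k) f) + (T ^ k) (f - T f) := by
      rw [pow_succ, mul_apply_eq_comp, map_sub]; abel
    -- Passing `Tᵏ` to the adjoint leaves a cross term of size at most `2k ℰ(T,f)`, so the increment
    -- is at most `(2k+1) ℰ(T,f)`, and `2k+1 = (k+1)² - k²`.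
    have h1 : inner ℝ ((T ^ k) (f - T f)) f
        = inner ℝ (f - T f) f - inner ℝ (f - T f) (f - (S ^ k) f) := by
      rw [inner_sub_right _ f, ← hSk, ContinuousLinearMap.adjoint_inner_right]; ring
    have h2 := norm_sub_apply_sq_le hT f
    have h3 := norm_sub_apply_sq_le (norm_adjoint_apply_le hT) f
    rw [← hS, hSf] at h3
    have h4 := norm_sub_pow_apply_le (norm_adjoint_apply_le hT) k f
    rw [← hS] at h4
    have h5 := abs_real_inner_le_norm (f - T f) (f - (S ^ k) f)
    have h6 : ‖f - T f‖ * ‖f - (S ^ k) f‖ ≤ k * (2 * inner ℝ (f - T f) f) := by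
      calc ‖f - T f‖ * ‖f - (S ^ k) f‖ ≤ ‖f - T f‖ * (k * ‖f - S f‖) := by gcongr
        _ = k * (‖f - T f‖ * ‖f - S f‖) := by ring
        _ ≤ k * (2 * inner ℝ (f - T f) f) := by
          refine mul_le_mul_of_nonneg_left ?_ (Nat.cast_nonneg k)
          nlinarith [sq_nonneg (‖f - T f‖ - ‖f - S f‖)]
    have h7 := (neg_abs_le (inner ℝ (f - T f) (f - (S ^ k) f)))
    rw [h, inner_add_left, h1, Nat.cast_succ]
    nlinarith

end Hilbert

/-! ### Weak Poincaré inequalities and convergence for a general sieve -/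

section WPI

variable {E : Type*} [MeasurableSpace E] {μ : Measure E}

theorem dirichletForm_adjoint (T : Lp ℝ 2 μ →L[ℝ] Lp ℝ 2 μ) (f : Lp ℝ 2 μ) :
    dirichletForm (ContinuousLinearMap.adjoint T) f = dirichletForm T f := by
  unfold dirichletForm
  rw [inner_sub_left, inner_sub_left, inner_adjoint_self]

theorem dirichletForm_adjoint_comp (T : Lp ℝ 2 μ →L[ℝ] Lp ℝ 2 μ) (f : Lp ℝ 2 μ) :
    dirichletForm (ContinuousLinearMap.adjoint T ∘L T) f = ‖f‖ ^ 2 - ‖T f‖ ^ 2 := by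
  unfold dirichletForm
  rw [inner_sub_left, real_inner_self_eq_norm_sq, ContinuousLinearMap.comp_apply,
    ContinuousLinearMap.adjoint_inner_left, real_inner_self_eq_norm_sq]

theorem dirichletForm_eq_half_add (T : Lp ℝ 2 μ →L[ℝ] Lp ℝ 2 μ) (f : Lp ℝ 2 μ) :
    2 * dirichletForm T f
      = dirichletForm (ContinuousLinearMap.adjoint T ∘L T) f + ‖f - T f‖ ^ 2 := by
  rw [dirichletForm_adjoint_comp, norm_sub_sq_real, dirichletForm, inner_sub_left,
    real_inner_self_eq_norm_sq, real_inner_comm]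
  ring

/-- The rate function of a weak Poincaré inequality may be chosen pointwise. -/
theorem satisfiesWPI_of_forall {Ψ : Lp ℝ 2 μ → ℝ≥0∞} {T : Lp ℝ 2 μ →L[ℝ] Lp ℝ 2 μ}
    (h : ∀ r, 0 < r → ∃ C : ℝ, 0 ≤ C ∧ ∀ f : Lp ℝ 2 μ, ∫ x, f x ∂μ = 0 → Ψ f ≠ ∞ →
      ‖f‖ ^ 2 ≤ C * dirichletForm T f + r * (Ψ f).toReal) :
    SatisfiesWPI Ψ T := by
  -- The admissible constants form a closed set that grows with `r`, so the least one is attained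
  -- and decreases in `r`.
  set S : ℝ → Set ℝ := fun r => {C | 0 ≤ C ∧ ∀ f : Lp ℝ 2 μ, ∫ x, f x ∂μ = 0 → Ψ f ≠ ∞ →
      ‖f‖ ^ 2 ≤ C * dirichletForm T f + r * (Ψ f).toReal} with hS
  have hbdd : ∀ r, BddBelow (S r) := fun r => ⟨0, fun C hC => hC.1⟩
  have hclosed : ∀ r, IsClosed (S r) := by
    intro r
    simp only [hS, Set.ofPred_and, Set.ofPred_forall]
    refine isClosed_Ici.inter ?_
    refine isClosed_iInter fun f => isClosed_iInter fun _ => isClosed_iInter fun _ => ?_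
    exact isClosed_le (by fun_prop) (by fun_prop)
  have hmem : ∀ r, 0 < r → sInf (S r) ∈ S r := fun r hr =>
    (hclosed r).csInf_mem (h r hr) (hbdd r)
  refine ⟨fun r => sInf (S r), ?_, fun r hr => (hmem r hr).1, fun r hr => (hmem r hr).2⟩
  intro r hr s _ hrs
  refine csInf_le (hbdd s) ⟨(hmem r hr).1, fun f h0 hf => ((hmem r hr).2 f h0 hf).trans ?_⟩
  gcongr

/-- A comparison of Dirichlet forms may lose any small multiple of `Ψ`: half of `r` pays for the WPI
of `T`, half for this loss. -/
theorem satisfiesWPI_of_le {Ψ : Lp ℝ 2 μ → ℝ≥0∞} {S T : Lp ℝ 2 μ →L[ℝ] Lp ℝ 2 μ}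
    (h : ∀ η : ℝ, 0 < η → ∃ C : ℝ, 0 ≤ C ∧ ∀ f : Lp ℝ 2 μ, ∫ x, f x ∂μ = 0 → Ψ f ≠ ∞ →
      dirichletForm T f ≤ C * dirichletForm S f + η * (Ψ f).toReal)
    (hT : SatisfiesWPI Ψ T) : SatisfiesWPI Ψ S := by
  obtain ⟨α, -, hα, hw⟩ := hT
  refine satisfiesWPI_of_forall fun r hr => ?_
  have ha := hα (r / 2) (by positivity)
  -- The `+ 1` covers `α (r / 2) = 0`.
  obtain ⟨C, hC, hCf⟩ := h (r / 2 / (α (r / 2) + 1)) (by positivity)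
  refine ⟨α (r / 2) * C, by positivity, fun f h0 hf => ?_⟩
  have h1 := hw (r / 2) (by positivity) f h0 hf
  have h2 := mul_le_mul_of_nonneg_left (hCf f h0 hf) ha
  have h3 : α (r / 2) * (r / 2 / (α (r / 2) + 1)) ≤ r / 2 := by
    rw [mul_div_assoc', div_le_iff₀ (by positivity)]
    nlinarith
  have h4 := mul_le_mul_of_nonneg_right h3 (ENNReal.toReal_nonneg (a := Ψ f))
  nlinarith

/-- A convergent contraction satisfies a weak Poincaré inequality. -/
theorem IsConvergent.satisfiesWPI {Ψ : Lp ℝ 2 μ → ℝ≥0∞} {T : Lp ℝ 2 μ →L[ℝ] Lp ℝ 2 μ}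
    (hT : ∀ f, ‖T f‖ ≤ ‖f‖)
    (hΨ : ∀ f : Lp ℝ 2 μ, ∫ x, f x ∂μ = 0 → Ψ f = 0 → f = 0)
    (h : IsConvergent Ψ T) : SatisfiesWPI Ψ T := by
  obtain ⟨γ, -, hγ, hc⟩ := h
  refine satisfiesWPI_of_forall fun r hr => ?_
  obtain ⟨n, hn⟩ := (hγ.eventually (gt_mem_nhds hr)).exists
  -- The `2` absorbs the `‖f‖²/2` coming from `⟨Tⁿf, f⟩ ≤ (‖Tⁿf‖² + ‖f‖²)/2`.
  refine ⟨2 * (n : ℝ) ^ 2, by positivity, fun f h0 hf => ?_⟩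
  rcases eq_or_ne (Ψ f) 0 with hz | hz
  · rw [hΨ f h0 hz]
    simp [dirichletForm]
    positivity
  have h1 := hc n f h0 (pos_iff_ne_zero.2 hz) hf
  have h2 := inner_sub_pow_apply_le hT n f
  rw [inner_sub_left, real_inner_self_eq_norm_sq] at h2
  have h3 := real_inner_le_norm ((T ^ n) f) f
  have h4 : γ n * (Ψ f).toReal ≤ r * (Ψ f).toReal := by gcongr
  unfold dirichletForm
  nlinarith [sq_nonneg (‖(T ^ n) f‖ - ‖f‖)]

/-- A weak Poincaré inequality for `T*T` makes `T` convergent. -/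
theorem SatisfiesWPI.isConvergent {Ψ : Lp ℝ 2 μ → ℝ≥0∞} {T : Lp ℝ 2 μ →L[ℝ] Lp ℝ 2 μ}
    (hT : ∀ f, ‖T f‖ ≤ ‖f‖)
    (hmean : ∀ f : Lp ℝ 2 μ, ∫ x, f x ∂μ = 0 → ∫ x, T f x ∂μ = 0)
    (hΨT : ∀ f : Lp ℝ 2 μ, Ψ (T f) ≤ Ψ f)
    (hΨ : ∀ f : Lp ℝ 2 μ, ∫ x, f x ∂μ = 0 → Ψ f ≠ ∞ → ‖f‖ ^ 2 ≤ (Ψ f).toReal)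
    (h : SatisfiesWPI Ψ (ContinuousLinearMap.adjoint T ∘L T)) : IsConvergent Ψ T := by
  obtain ⟨α, -, hα, hw⟩ := h
  -- The supremum of these ratios is the optimal rate at time `n`.
  set S : ℕ → Set ℝ := fun n => {u | ∃ f : Lp ℝ 2 μ, ∫ x, f x ∂μ = 0 ∧ 0 < Ψ f ∧ Ψ f ≠ ∞ ∧
    u = ‖(T ^ n) f‖ ^ 2 / (Ψ f).toReal} with hS
  have hpos : ∀ f : Lp ℝ 2 μ, 0 < Ψ f → Ψ f ≠ ∞ → 0 < (Ψ f).toReal := fun f h0 h1 =>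
    ENNReal.toReal_pos h0.ne' h1
  have hbdd : ∀ n, BddAbove (S n) := by
    refine fun n => ⟨1, ?_⟩
    rintro u ⟨f, h0, h1, h2, rfl⟩
    rw [div_le_one (hpos f h1 h2)]
    exact (pow_le_pow_left₀ (norm_nonneg _) (norm_pow_apply_le hT n f) 2).trans (hΨ f h0 h2)
  have hnn : ∀ n, 0 ≤ sSup (S n) := by
    refine fun n => Real.sSup_nonneg ?_
    rintro u ⟨f, h0, h1, h2, rfl⟩
    positivity
  have hmeank : ∀ (k : ℕ) (f : Lp ℝ 2 μ), ∫ x, f x ∂μ = 0 → ∫ x, (T ^ k) f x ∂μ = 0 := by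
    intro k f h0
    induction k with
    | zero => simpa using h0
    | succ k ih => rw [pow_succ', mul_apply_eq_comp]; exact hmean _ ih
  have hΨk : ∀ (k : ℕ) (f : Lp ℝ 2 μ), Ψ ((T ^ k) f) ≤ Ψ f := by
    intro k f
    induction k with
    | zero => simp
    | succ k ih => rw [pow_succ', mul_apply_eq_comp]; exact (hΨT _).trans ih
  have hstep : ∀ (r : ℝ), 0 < r → ∀ (f : Lp ℝ 2 μ), ∫ x, f x ∂μ = 0 → Ψ f ≠ ∞ → ∀ k : ℕ,
      ‖(T ^ k) f‖ ^ 2 ≤ α r * (‖(T ^ k) f‖ ^ 2 - ‖(T ^ (k + 1)) f‖ ^ 2)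
        + r * (Ψ f).toReal := by
    intro r hr f h0 h2 k
    have h3 := hw r hr ((T ^ k) f) (hmeank k f h0) ((hΨk k f).trans_lt h2.lt_top).ne
    rw [dirichletForm_adjoint_comp, ← mul_apply_eq_comp, ← pow_succ'] at h3
    have h4 := ENNReal.toReal_mono h2 (hΨk k f)
    nlinarith
  have hdec : ∀ f : Lp ℝ 2 μ, Antitone fun k : ℕ => ‖(T ^ k) f‖ ^ 2 := by
    refine fun f => antitone_nat_of_succ_le fun k => ?_
    rw [pow_succ' T, mul_apply_eq_comp]
    exact pow_le_pow_left₀ (norm_nonneg _) (hT _) 2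
  -- The optimal rate may vanish; `1/(n+1)` makes `γ` positive.
  refine ⟨fun n => sSup (S n) + 1 / ((n : ℝ) + 1), fun n => ?_, ?_, ?_⟩
  · have := hnn n
    positivity
  · suffices hlim : Tendsto (fun n => sSup (S n)) atTop (𝓝 0) by
      simpa using hlim.add tendsto_one_div_add_atTop_nhds_zero_nat
    rw [Metric.tendsto_atTop]
    intro ε hε
    set r := ε / 4 with hr
    have hr0 : 0 < r := by positivity
    obtain ⟨N, hN⟩ := exists_nat_gt (α r / r)
    refine ⟨N, fun n hn => ?_⟩
    rw [Real.dist_0_eq_abs, abs_of_nonneg (hnn n)]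
    refine lt_of_le_of_lt (Real.sSup_le (a := 2 * r) ?_ (by positivity)) (by linarith)
    rintro u ⟨f, h0, h1, h2, rfl⟩
    have hp := hpos f h1 h2
    rw [div_le_iff₀ hp]
    -- If `‖Tⁿf‖² > 2rΨ(f)`, every earlier iterate is as large, so `α(r)` times each decrement
    -- exceeds `rΨ(f)`. Summing, `n r Ψ(f) ≤ α(r) Ψ(f)`, against `n r > α(r)`.
    by_contra! hlt
    have hsum : ∀ k ≤ n, k * (r * (Ψ f).toReal) ≤ α r * (‖f‖ ^ 2 - ‖(T ^ k) f‖ ^ 2) := by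
      intro k
      induction k with
      | zero => simp
      | succ k ih =>
        intro hk
        have h3 := ih (by omega)
        have h4 := hstep r hr0 f h0 h2 k
        have h5 : ‖(T ^ n) f‖ ^ 2 ≤ ‖(T ^ k) f‖ ^ 2 := hdec f (by omega)
        rw [Nat.cast_succ]
        nlinarith
    have h3 := hsum n le_rfl
    have h4 := hΨ f h0 h2
    have h5 : α r * (‖f‖ ^ 2 - ‖(T ^ n) f‖ ^ 2) ≤ α r * (Ψ f).toReal := by
      have := hα r hr0
      gcongr
      nlinarith [sq_nonneg ‖(T ^ n) f‖]
    have h6 : (N : ℝ) ≤ n := by exact_mod_cast hn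
    rw [div_lt_iff₀ hr0] at hN
    have h7 : α r < n * r := by nlinarith
    nlinarith
  · intro n f h0 h1 h2
    have hp := hpos f h1 h2
    have h3 : ‖(T ^ n) f‖ ^ 2 / (Ψ f).toReal ≤ sSup (S n) :=
      le_csSup (hbdd n) ⟨f, h0, h1, h2, rfl⟩
    rw [div_le_iff₀ hp] at h3
    refine h3.trans ?_
    gcongr
    simp only [le_add_iff_nonneg_right]
    positivity

end WPI

/-! ### The oscillation sieve -/

section Osc

variable {E : Type*} [MeasurableSpace E] {μ : Measure E}

theorem norm_sq_eq_integral (f : Lp ℝ 2 μ) : ‖f‖ ^ 2 = ∫ x, f x ^ 2 ∂μ := by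
  rw [← real_inner_self_eq_norm_sq, L2.inner_def]
  simp [pow_two]

theorem inner_eq_integral_mul (f g : Lp ℝ 2 μ) : inner ℝ f g = ∫ x, f x * g x ∂μ := by
  rw [L2.inner_def]
  simp [mul_comm]

theorem oscNorm_le_of_ae {f : Lp ℝ 2 μ} {a b : ℝ} (ha : ∀ᵐ x ∂μ, a ≤ f x)
    (hb : ∀ᵐ x ∂μ, f x ≤ b) : oscNorm f ≤ ENNReal.ofReal (b - a) := by
  rw [← EReal.real_coe_toENNReal, EReal.coe_sub]
  refine EReal.toENNReal_le_toENNReal (EReal.sub_le_sub ?_ ?_)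
  · exact essSup_le_of_ae_le _ (hb.mono fun x hx => EReal.coe_le_coe_iff.2 hx)
  · exact le_essInf_of_ae_le _ (ha.mono fun x hx => EReal.coe_le_coe_iff.2 hx)

theorem exists_ae_bounds_of_oscNorm_ne_top [NeZero μ] {f : Lp ℝ 2 μ} (hf : oscNorm f ≠ ∞) :
    ∃ a b : ℝ, (∀ᵐ x ∂μ, a ≤ f x) ∧ (∀ᵐ x ∂μ, f x ≤ b) ∧ (oscNorm f).toReal = b - a := by
  unfold oscNorm at hf ⊢
  set s := essSup (fun x => ((f x : ℝ) : EReal)) μ with hs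
  set i := essInf (fun x => ((f x : ℝ) : EReal)) μ with hi
  have hle : ∀ᵐ x ∂μ, ((f x : ℝ) : EReal) ≤ s := ae_le_essSup
  have hge : ∀ᵐ x ∂μ, i ≤ ((f x : ℝ) : EReal) := ae_essInf_le
  -- One point obeying both bounds excludes `s = ⊥` and `i = ⊤`; finiteness of `s - i` then makes
  -- both real.
  obtain ⟨x, hxs, hxi⟩ := (hle.and hge).exists
  have hs1 : s ≠ ⊥ := fun h => by simp [h] at hxs
  have hi1 : i ≠ ⊤ := fun h => by simp [h] at hxi
  have hd : s - i ≠ ⊤ := EReal.toENNReal_ne_top_iff.1 hf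
  have hs2 : s ≠ ⊤ := by
    intro h
    rw [h] at hd
    exact hd (EReal.top_sub hi1)
  have hi2 : i ≠ ⊥ := by
    intro h
    rw [h] at hd
    exact hd (EReal.sub_bot hs1)
  lift s to ℝ using ⟨hs2, hs1⟩ with s'
  lift i to ℝ using ⟨hi1, hi2⟩ with i'
  refine ⟨i', s', hge.mono fun x hx => EReal.coe_le_coe_iff.1 hx,
    hle.mono fun x hx => EReal.coe_le_coe_iff.1 hx, ?_⟩
  rw [← EReal.coe_sub, EReal.real_coe_toENNReal, ENNReal.toReal_ofReal]
  have := EReal.coe_le_coe_iff.1 (hxi.trans hxs)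
  linarith

theorem toReal_oscSieve (f : Lp ℝ 2 μ) : (oscSieve f).toReal = (oscNorm f).toReal ^ 2 := by
  rw [oscSieve, ENNReal.toReal_pow]

theorem oscNorm_ne_top_of_oscSieve {f : Lp ℝ 2 μ} (h : oscSieve f ≠ ∞) : oscNorm f ≠ ∞ := by
  intro h'
  simp [oscSieve, h'] at h

theorem norm_sq_le_of_ae_abs_le [IsProbabilityMeasure μ] {f : Lp ℝ 2 μ} {M : ℝ}
    (h : ∀ᵐ x ∂μ, |f x| ≤ M) : ‖f‖ ^ 2 ≤ M ^ 2 := by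
  rw [norm_sq_eq_integral]
  calc ∫ x, f x ^ 2 ∂μ ≤ ∫ _, M ^ 2 ∂μ := by
        refine integral_mono_of_nonneg (ae_of_all _ fun x => sq_nonneg _) (integrable_const _) ?_
        filter_upwards [h] with x hx
        rw [← sq_abs]
        exact pow_le_pow_left₀ (abs_nonneg _) hx 2
    _ = M ^ 2 := by simp

/-- A mean-zero function is bounded by its oscillation. -/
theorem norm_sq_le_oscSieve [IsProbabilityMeasure μ] {f : Lp ℝ 2 μ} (h0 : ∫ x, f x ∂μ = 0)
    (hf : oscSieve f ≠ ∞) : ‖f‖ ^ 2 ≤ (oscSieve f).toReal := by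
  obtain ⟨a, b, ha, hb, hab⟩ :=
    exists_ae_bounds_of_oscNorm_ne_top (oscNorm_ne_top_of_oscSieve hf)
  rw [toReal_oscSieve, hab]
  have hint : Integrable f μ := (Lp.memLp f).integrable (by norm_num)
  -- Mean zero forces `a ≤ 0 ≤ b`, hence `|f| ≤ b - a`.
  have h1 : a ≤ 0 := by
    have := integral_mono_ae (integrable_const a) hint ha
    simpa [h0] using this
  have h2 : 0 ≤ b := by
    have := integral_mono_ae hint (integrable_const b) hb
    simpa [h0] using this
  refine norm_sq_le_of_ae_abs_le ?_
  filter_upwards [ha, hb] with x hxa hxb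
  rw [abs_le]
  constructor <;> linarith

theorem eq_zero_of_oscSieve_eq_zero [IsProbabilityMeasure μ] {f : Lp ℝ 2 μ}
    (h0 : ∫ x, f x ∂μ = 0) (hf : oscSieve f = 0) : f = 0 := by
  have h := norm_sq_le_oscSieve h0 (by simp [hf])
  rw [hf, ENNReal.toReal_zero] at h
  exact norm_eq_zero.1 (pow_eq_zero_iff two_ne_zero |>.1 (le_antisymm h (sq_nonneg _)))

theorem ae_le_apply_of_ae_apply_le {T : Lp ℝ 2 μ →L[ℝ] Lp ℝ 2 μ}
    (hT : ∀ (f : Lp ℝ 2 μ) (b : ℝ), (∀ᵐ x ∂μ, f x ≤ b) → ∀ᵐ x ∂μ, T f x ≤ b)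
    {f : Lp ℝ 2 μ} {a : ℝ} (ha : ∀ᵐ x ∂μ, a ≤ f x) : ∀ᵐ x ∂μ, a ≤ T f x := by
  have h1 : ∀ᵐ x ∂μ, (-f : Lp ℝ 2 μ) x ≤ -a := by
    filter_upwards [ha, Lp.coeFn_neg f] with x hx hn
    rw [hn, Pi.neg_apply]
    linarith
  have h2 := hT _ _ h1
  rw [map_neg] at h2
  filter_upwards [h2, Lp.coeFn_neg (T f)] with x hx hn
  rw [hn, Pi.neg_apply] at hx
  linarith

theorem oscSieve_apply_le [NeZero μ] {T : Lp ℝ 2 μ →L[ℝ] Lp ℝ 2 μ}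
    (hT : ∀ (f : Lp ℝ 2 μ) (b : ℝ), (∀ᵐ x ∂μ, f x ≤ b) → ∀ᵐ x ∂μ, T f x ≤ b)
    (f : Lp ℝ 2 μ) : oscSieve (T f) ≤ oscSieve f := by
  refine pow_le_pow_left₀ zero_le ?_ 2
  by_cases hf : oscNorm f = ∞
  · simp [hf]
  obtain ⟨a, b, ha, hb, hab⟩ := exists_ae_bounds_of_oscNorm_ne_top hf
  rw [← ENNReal.ofReal_toReal hf, hab]
  exact oscNorm_le_of_ae (ae_le_apply_of_ae_apply_le hT ha) (hT f b hb)

theorem ae_abs_sub_apply_le [NeZero μ] {T : Lp ℝ 2 μ →L[ℝ] Lp ℝ 2 μ}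
    (hT : ∀ (f : Lp ℝ 2 μ) (b : ℝ), (∀ᵐ x ∂μ, f x ≤ b) → ∀ᵐ x ∂μ, T f x ≤ b)
    {f : Lp ℝ 2 μ} (hf : oscNorm f ≠ ∞) :
    ∀ᵐ x ∂μ, |f x - T f x| ≤ (oscNorm f).toReal := by
  obtain ⟨a, b, ha, hb, hab⟩ := exists_ae_bounds_of_oscNorm_ne_top hf
  filter_upwards [ha, hb, ae_le_apply_of_ae_apply_le hT ha, hT f b hb] with x h1 h2 h3 h4
  rw [hab, abs_le]
  constructor <;> linarith

theorem satisfiesWPI_adjoint_iff {Ψ : Lp ℝ 2 μ → ℝ≥0∞} {T : Lp ℝ 2 μ →L[ℝ] Lp ℝ 2 μ} :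
    SatisfiesWPI Ψ (ContinuousLinearMap.adjoint T) ↔ SatisfiesWPI Ψ T := by
  simp only [SatisfiesWPI, dirichletForm_adjoint]

theorem satisfiesWPI_adjoint_comp_of_holding {T : Lp ℝ 2 μ →L[ℝ] Lp ℝ 2 μ}
    (hT : ∀ η : ℝ, 0 < η → ∃ δ : ℝ, 0 < δ ∧ ∀ f : Lp ℝ 2 μ, oscNorm f ≠ ∞ →
      δ * ‖f - T f‖ ^ 2 ≤ dirichletForm (ContinuousLinearMap.adjoint T ∘L T) f
        + δ * (η * (oscNorm f).toReal ^ 2))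
    (h : SatisfiesWPI oscSieve T) :
    SatisfiesWPI oscSieve (ContinuousLinearMap.adjoint T ∘L T) := by
  refine satisfiesWPI_of_le (fun η hη => ?_) h
  obtain ⟨δ, hδ, hδf⟩ := hT (2 * η) (by positivity)
  refine ⟨(1 + 1 / δ) / 2, by positivity, fun f _ hf => ?_⟩
  have h1 := hδf f (oscNorm_ne_top_of_oscSieve hf)
  have h2 := dirichletForm_eq_half_add T f
  rw [toReal_oscSieve]
  set D := dirichletForm (ContinuousLinearMap.adjoint T ∘L T) f
  have h3 : ‖f - T f‖ ^ 2 ≤ D / δ + 2 * η * (oscNorm f).toReal ^ 2 := by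
    rw [← mul_le_mul_iff_right₀ hδ, mul_add, mul_div_cancel₀ _ hδ.ne']
    exact h1
  have h4 : (1 + 1 / δ) / 2 * D = (D + D / δ) / 2 := by ring
  linarith

end Osc

/-! ### Markov kernels, the adjoint, and holding probabilities -/

section Kernel

variable {E : Type*} [MeasurableSpace E] {μ : Measure E} {P : Kernel E E}

theorem integrable_integral_kernel (hP : P.Invariant μ) {h : E → ℝ} (hh : Integrable h μ) :
    Integrable (fun x => ∫ y, h y ∂(P x)) μ := by
  have hbind : μ.bind P = μ := hP
  have h' : Integrable h (μ.bind P) := by rwa [hbind]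
  refine (Measure.integrable_integral_norm_of_integrable_comp h').mono
    ?_ (ae_of_all _ fun x => ?_)
  · have := h'.1
    rw [Measure.comp_eq_comp_const_apply] at this
    simpa using this.integral_kernel_comp
  · rw [Real.norm_of_nonneg (integral_nonneg fun _ => norm_nonneg _)]
    exact norm_integral_le_integral_norm _

theorem integral_integral_kernel (hP : P.Invariant μ) {h : E → ℝ} (hh : Integrable h μ) :
    ∫ x, ∫ y, h y ∂(P x) ∂μ = ∫ x, h x ∂μ := by
  have hbind : μ.bind P = μ := hP
  have h' : Integrable h (μ.bind P) := by rwa [hbind]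
  rw [Measure.comp_eq_comp_const_apply] at h'
  have := Kernel.integral_comp h'
  rw [← Measure.comp_eq_comp_const_apply, hbind] at this
  simpa using this.symm

theorem ae_ae_kernel (hP : P.Invariant μ) {p : E → Prop} (h : ∀ᵐ x ∂μ, p x) :
    ∀ᵐ x ∂μ, ∀ᵐ y ∂(P x), p y := by
  have hbind : μ.bind P = μ := hP
  rw [← hbind] at h
  exact Measure.ae_ae_of_ae_comp h

variable [IsProbabilityMeasure μ] [IsMarkovKernel P]

theorem markovOp_apply_le_norm (hP : P.Invariant μ) (f : Lp ℝ 2 μ) :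
    ‖markovOp μ P hP f‖ ≤ ‖f‖ :=
  ((markovOp μ P hP).le_of_opNorm_le (LinearMap.mkContinuous_norm_le _ zero_le_one _) f).trans_eq
    (one_mul _)

theorem integral_markovOp (hP : P.Invariant μ) (f : Lp ℝ 2 μ) :
    ∫ x, markovOp μ P hP f x ∂μ = ∫ x, f x ∂μ := by
  rw [integral_congr_ae (markovOp_apply_ae μ P hP f)]
  exact integral_integral_kernel hP ((Lp.memLp f).integrable (by norm_num))

theorem markovOp_ae_le (hP : P.Invariant μ) (f : Lp ℝ 2 μ) (b : ℝ) (hb : ∀ᵐ x ∂μ, f x ≤ b) :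
    ∀ᵐ x ∂μ, markovOp μ P hP f x ≤ b := by
  filter_upwards [markovOp_apply_ae μ P hP f, ae_ae_kernel hP hb, ae_integrable_kernel hP f]
    with x h1 h2 h3
  rw [h1]
  simpa using integral_mono_ae h3 (integrable_const b) h2

/-- The adjoint need not come from a kernel, so it is accessed by pairing with indicators. -/
theorem setIntegral_adjoint_markovOp (hP : P.Invariant μ) (f : Lp ℝ 2 μ) {s : Set E}
    (hs : MeasurableSet s) :
    ∫ x in s, ContinuousLinearMap.adjoint (markovOp μ P hP) f x ∂μ
      = ∫ x, (P x).real s * f x ∂μ := by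
  rw [← L2.inner_indicatorConstLp_one hs (measure_ne_top μ s),
    ContinuousLinearMap.adjoint_inner_right, inner_eq_integral_mul]
  refine integral_congr_ae ?_
  filter_upwards [markovOp_apply_ae μ P hP (indicatorConstLp 2 hs (measure_ne_top μ s) (1 : ℝ)),
    ae_ae_kernel hP (indicatorConstLp_coeFn (p := 2) (hs := hs) (hμs := measure_ne_top μ s)
      (c := (1 : ℝ)))] with x h1 h2
  rw [h1, integral_congr_ae h2, integral_indicator_const _ hs]
  simp

theorem integral_adjoint_markovOp (hP : P.Invariant μ) (f : Lp ℝ 2 μ) :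
    ∫ x, ContinuousLinearMap.adjoint (markovOp μ P hP) f x ∂μ = ∫ x, f x ∂μ := by
  have h := setIntegral_adjoint_markovOp hP f MeasurableSet.univ
  simpa using h

/-- By invariance `∫ P(x,s) μ(dx) = μ(s)`, so the integral of the adjoint's value over any `s` is at
most `b μ(s)`. -/
theorem adjoint_markovOp_ae_le (hP : P.Invariant μ) (f : Lp ℝ 2 μ) (b : ℝ)
    (hb : ∀ᵐ x ∂μ, f x ≤ b) :
    ∀ᵐ x ∂μ, ContinuousLinearMap.adjoint (markovOp μ P hP) f x ≤ b := by
  have hint : Integrable f μ := (Lp.memLp f).integrable (by norm_num)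
  refine ae_le_of_forall_setIntegral_le
    ((Lp.memLp (ContinuousLinearMap.adjoint (markovOp μ P hP) f)).integrable (by norm_num))
    (integrable_const b) fun s hs _ => ?_
  have hs' : Integrable (s.indicator fun _ => (1 : ℝ)) μ := (integrable_const 1).indicator hs
  have hreal : ∀ x, ∫ y, s.indicator (fun _ => (1 : ℝ)) y ∂(P x) = (P x).real s := fun x => by
    rw [integral_indicator_const _ hs]; simp
  have hPs := integrable_integral_kernel hP hs'
  have hPs' := integral_integral_kernel hP hs'
  simp only [hreal] at hPs hPs'
  rw [integral_indicator_const _ hs, smul_eq_mul, mul_one] at hPs'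
  rw [setIntegral_adjoint_markovOp hP f hs]
  calc ∫ x, (P x).real s * f x ∂μ ≤ ∫ x, (P x).real s * b ∂μ := by
        refine integral_mono_ae (hint.bdd_mul (c := 1) hPs.1 (ae_of_all _ fun x => ?_))
          (hPs.mul_const b) ?_
        · rw [Real.norm_of_nonneg measureReal_nonneg]
          exact measureReal_le_one
        · filter_upwards [hb] with x hx
          exact mul_le_mul_of_nonneg_left hx measureReal_nonneg
    _ = ∫ x in s, b ∂μ := by
        rw [integral_mul_const, hPs', setIntegral_const, smul_eq_mul]

theorem measurable_kernel_fiber {g : E → ℝ} (hg : Measurable g) :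
    Measurable fun x => P x {y | g y = g x} :=
  Kernel.measurable_kernel_prodMk_left (t := {p : E × E | g p.2 = g p.1})
    (measurableSet_eq_fun (by fun_prop) (by fun_prop))

/-- With positive holding probabilities, the probability of staying in the fibre of a real
function is bounded below off a set of small measure, uniformly in the function. -/
theorem PositiveHolding.exists_uniform (hPH : PositiveHolding μ P) {η : ℝ} (hη : 0 < η) :
    ∃ δ : ℝ, 0 < δ ∧ ∀ g : E → ℝ, Measurable g →
      μ.real {x | (P x).real {y | g y = g x} < δ} ≤ η := by
  by_contra! hcon
  choose g hg hlt using fun n : ℕ => hcon (1 / ((n : ℝ) + 1)) (by positivity)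
  -- Singletons may be non-measurable; the common fibre of the countably many `g n` is a measurable
  -- set containing `x` and lying in every single fibre.
  set A : E → Set E := fun x => {y | ∀ n, g n y = g n x} with hA
  have hAm : Measurable fun x => P x (A x) := by
    refine Kernel.measurable_kernel_prodMk_left (t := {p : E × E | ∀ n, g n p.2 = g n p.1}) ?_
    rw [Set.ofPred_forall]
    refine MeasurableSet.iInter fun n => measurableSet_eq_fun ?_ ?_
    · exact (hg n).comp measurable_snd
    · exact (hg n).comp measurable_fst
  set S : ℕ → Set E := fun n => {x | (P x).real (A x) < 1 / ((n : ℝ) + 1)} with hS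
  have hSm : ∀ n, MeasurableSet (S n) := fun n => hAm.ennreal_toReal measurableSet_Iio
  have hSanti : Antitone S := by
    intro m n hmn x hx
    exact lt_of_lt_of_le (Set.mem_ofPred.1 hx) (Nat.one_div_le_one_div hmn)
  have hSη : ∀ n, η ≤ μ.real (S n) := fun n =>
    (hlt n).le.trans <| measureReal_mono fun x hx =>
      lt_of_le_of_lt (measureReal_mono fun y (hy : y ∈ A x) => hy n) (Set.mem_ofPred.1 hx)
  have hnull : μ (⋂ n, S n) = 0 := by
    -- The `S n` decrease to `{x | P(x, A x) = 0}`, null by holding, yet each has mass at least `η`: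
    -- continuity from above is violated.
    refine measure_mono_null (fun x hx => ?_) hPH
    have h0 : (P x).real (A x) ≤ 0 :=
      ge_of_tendsto' tendsto_one_div_add_atTop_nhds_zero_nat
        fun n => le_of_lt (Set.mem_iInter.1 hx n)
    have h1 : P x (A x) = 0 := by
      rw [← measureReal_eq_zero_iff]
      exact le_antisymm h0 measureReal_nonneg
    refine measure_mono_null (t := A x) (Set.singleton_subset_iff.2 ?_) h1
    exact fun n => rfl
  have hlim := tendsto_measure_iInter_atTop (μ := μ) (fun n => (hSm n).nullMeasurableSet) hSanti
    ⟨0, measure_ne_top _ _⟩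
  rw [hnull] at hlim
  have hlim' := (ENNReal.tendsto_toReal ENNReal.zero_ne_top).comp hlim
  exact absurd (ge_of_tendsto' hlim' hSη) (by simpa using hη)

/-- If `(X, Y)` is a stationary transition of the chain, then
`∫ P(x, {g = g x}) (f x - g x)² μ(dx) ≤ 𝔼 (f X - g Y)²`. -/
theorem integral_fiber_mul_sq_le (hP : P.Invariant μ) (f g : Lp ℝ 2 μ) :
    ∫ x, (P x).real {y | g y = g x} * (f x - g x) ^ 2 ∂μ
      ≤ ‖f‖ ^ 2 - 2 * inner ℝ f (markovOp μ P hP g) + ‖g‖ ^ 2 := by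
  have hbind : μ.bind P = μ := hP
  have hf2 : Integrable (fun x => f x ^ 2) μ := (Lp.memLp f).integrable_sq
  have hg2 : Integrable (fun x => g x ^ 2) μ := (Lp.memLp g).integrable_sq
  have hfg : Integrable (fun x => f x * markovOp μ P hP g x) μ :=
    (Lp.memLp f).integrable_mul (Lp.memLp _)
  have hPg2 := integrable_integral_kernel hP hg2
  have hae : ∀ᵐ x ∂μ, Integrable (fun y => g y ^ 2) (P x) := by
    refine Measure.ae_integrable_of_integrable_comp (μ := μ) ?_
    rwa [hbind]
  have hgm : Measurable g := (Lp.stronglyMeasurable g).measurable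
  calc ∫ x, (P x).real {y | g y = g x} * (f x - g x) ^ 2 ∂μ
      ≤ ∫ x, (f x ^ 2 - 2 * (f x * markovOp μ P hP g x) + ∫ y, g y ^ 2 ∂(P x)) ∂μ := by
        refine integral_mono_of_nonneg
          (ae_of_all _ fun x => mul_nonneg measureReal_nonneg (sq_nonneg _))
          ((hf2.sub (hfg.const_mul 2)).add hPg2) ?_
        filter_upwards [hae, ae_integrable_kernel hP g, markovOp_apply_ae μ P hP g]
          with x h1 h2 h3
        have hA : MeasurableSet {y | g y = g x} := hgm (measurableSet_singleton (g x))
        have hi1 : Integrable (fun y => f x ^ 2 - 2 * f x * g y) (P x) :=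
          (integrable_const _).sub (h2.const_mul _)
        have hi : Integrable (fun y => f x ^ 2 - 2 * f x * g y + g y ^ 2) (P x) := hi1.add h1
        -- The integrand is `(f x - g y)²`: nonnegative, and constant on the fibre.
        calc (P x).real {y | g y = g x} * (f x - g x) ^ 2
            = ∫ y in {y | g y = g x}, (f x ^ 2 - 2 * f x * g y + g y ^ 2) ∂(P x) := by
              rw [← smul_eq_mul, ← setIntegral_const]
              refine setIntegral_congr_fun hA fun y (hy : g y = g x) => ?_
              simp only [hy]
              ring
          _ ≤ ∫ y, (f x ^ 2 - 2 * f x * g y + g y ^ 2) ∂(P x) := by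
              refine setIntegral_le_integral hi (ae_of_all _ fun y => ?_)
              change 0 ≤ f x ^ 2 - 2 * f x * g y + g y ^ 2
              nlinarith [sq_nonneg (f x - g y)]
          _ = f x ^ 2 - 2 * (f x * markovOp μ P hP g x) + ∫ y, g y ^ 2 ∂(P x) := by
              rw [integral_add hi1 h1, integral_sub (integrable_const _) (h2.const_mul _),
                integral_const_mul, h3]
              simp
              ring
    _ = ‖f‖ ^ 2 - 2 * inner ℝ f (markovOp μ P hP g) + ‖g‖ ^ 2 := by
        have hi := hf2.sub (hfg.const_mul 2)
        simp only [Pi.sub_def] at hi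
        rw [integral_add hi hPg2, integral_sub hf2 (hfg.const_mul 2),
          integral_const_mul, integral_integral_kernel hP hg2, norm_sq_eq_integral,
          norm_sq_eq_integral, inner_eq_integral_mul]

/-- Off the exceptional set the fibre weight is at least `δ`; on it, of mass at most `η`, the crude
bound `M²` is paid. -/
theorem mul_norm_sub_sq_le (hP : P.Invariant μ) {f g : Lp ℝ 2 μ} {δ η M : ℝ} (hδ : 0 < δ)
    (hη : μ.real {x | (P x).real {y | g y = g x} < δ} ≤ η)
    (hM : ∀ᵐ x ∂μ, |f x - g x| ≤ M) :
    δ * ‖f - g‖ ^ 2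
      ≤ ‖f‖ ^ 2 - 2 * inner ℝ f (markovOp μ P hP g) + ‖g‖ ^ 2 + δ * (η * M ^ 2) := by
  have hgm : Measurable g := (Lp.stronglyMeasurable g).measurable
  have hεm : Measurable fun x => (P x).real {y | g y = g x} :=
    (measurable_kernel_fiber hgm).ennreal_toReal
  set S := {x | (P x).real {y | g y = g x} < δ} with hS
  have hSm : MeasurableSet S := hεm measurableSet_Iio
  have hfg2 : Integrable (fun x => (f x - g x) ^ 2) μ :=
    ((Lp.memLp f).sub (Lp.memLp g)).integrable_sq
  have hε2 : Integrable (fun x => (P x).real {y | g y = g x} * (f x - g x) ^ 2) μ := by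
    refine hfg2.bdd_mul (c := 1) hεm.aestronglyMeasurable (ae_of_all _ fun x => ?_)
    rw [Real.norm_of_nonneg measureReal_nonneg]
    exact measureReal_le_one
  have hS2 : Integrable (S.indicator fun _ => δ * M ^ 2) μ := (integrable_const _).indicator hSm
  have h1 : δ * ‖f - g‖ ^ 2 ≤ ∫ x, ((P x).real {y | g y = g x} * (f x - g x) ^ 2
      + S.indicator (fun _ => δ * M ^ 2) x) ∂μ := by
    rw [norm_sq_eq_integral, ← integral_const_mul]
    refine integral_mono_of_nonneg (ae_of_all _ fun x => mul_nonneg hδ.le (sq_nonneg _))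
      (hε2.add hS2) ?_
    filter_upwards [Lp.coeFn_sub f g, hM] with x hx hxM
    rw [hx, Pi.sub_apply]
    by_cases hxS : x ∈ S
    · rw [Set.indicator_of_mem hxS]
      have h2 : (f x - g x) ^ 2 ≤ M ^ 2 := by
        rw [← sq_abs]
        exact pow_le_pow_left₀ (abs_nonneg _) hxM 2
      have h3 : 0 ≤ (P x).real {y | g y = g x} * (f x - g x) ^ 2 :=
        mul_nonneg measureReal_nonneg (sq_nonneg _)
      nlinarith
    · rw [Set.indicator_of_notMem hxS, add_zero]
      exact mul_le_mul_of_nonneg_right (not_lt.1 hxS) (sq_nonneg _)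
  rw [integral_add hε2 hS2, integral_indicator_const _ hSm, smul_eq_mul] at h1
  have h2 := integral_fiber_mul_sq_le hP f g
  have h3 : μ.real S * (δ * M ^ 2) ≤ η * (δ * M ^ 2) :=
    mul_le_mul_of_nonneg_right hη (by positivity)
  linarith

theorem SatisfiesWPI.adjoint_comp_markovOp (hP : P.Invariant μ) (hPH : PositiveHolding μ P)
    (h : SatisfiesWPI oscSieve (markovOp μ P hP)) :
    SatisfiesWPI oscSieve
      (ContinuousLinearMap.adjoint (markovOp μ P hP) ∘L markovOp μ P hP) := by
  refine satisfiesWPI_adjoint_comp_of_holding (fun η hη => ?_) h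
  obtain ⟨δ, hδ, hg⟩ := hPH.exists_uniform hη
  refine ⟨δ, hδ, fun f hf => ?_⟩
  have h1 := mul_norm_sub_sq_le hP (f := markovOp μ P hP f) (g := f) hδ
    (hg f (Lp.stronglyMeasurable f).measurable)
    ((ae_abs_sub_apply_le (markovOp_ae_le hP) hf).mono fun x hx => by rwa [abs_sub_comm])
  rw [real_inner_self_eq_norm_sq, norm_sub_rev] at h1
  rw [dirichletForm_adjoint_comp]
  linarith

/-- The fibres are now those of `g = P*f`, and `⟨f, P P*f⟩ = ‖P*f‖²` reduces the second moment to
`‖f‖² - ‖P*f‖²`. -/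
theorem SatisfiesWPI.markovOp_comp_adjoint (hP : P.Invariant μ) (hPH : PositiveHolding μ P)
    (h : SatisfiesWPI oscSieve (ContinuousLinearMap.adjoint (markovOp μ P hP))) :
    SatisfiesWPI oscSieve
      (markovOp μ P hP ∘L ContinuousLinearMap.adjoint (markovOp μ P hP)) := by
  have h' := satisfiesWPI_adjoint_comp_of_holding (fun η hη => ?_) h
  · rwa [ContinuousLinearMap.adjoint_adjoint] at h'
  obtain ⟨δ, hδ, hg⟩ := hPH.exists_uniform hη
  refine ⟨δ, hδ, fun f hf => ?_⟩
  have h1 := mul_norm_sub_sq_le hP (f := f)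
    (g := ContinuousLinearMap.adjoint (markovOp μ P hP) f) hδ
    (hg _ (Lp.stronglyMeasurable _).measurable)
    (ae_abs_sub_apply_le (adjoint_markovOp_ae_le hP) hf)
  rw [← ContinuousLinearMap.adjoint_inner_left, real_inner_self_eq_norm_sq] at h1
  rw [dirichletForm_adjoint_comp]
  linarith

end Kernel

end MarkovWPI

theorem mainTheorem4 {E : Type*} [MeasurableSpace E] (μ : Measure E) [IsProbabilityMeasure μ]
    (P : Kernel E E) [IsMarkovKernel P] (hP : P.Invariant μ)
    (hPH : MarkovWPI.PositiveHolding μ P) :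
    List.TFAE [
      MarkovWPI.SatisfiesWPI MarkovWPI.oscSieve (MarkovWPI.markovOp μ P hP),
      MarkovWPI.SatisfiesWPI MarkovWPI.oscSieve
        (ContinuousLinearMap.adjoint (MarkovWPI.markovOp μ P hP) ∘L MarkovWPI.markovOp μ P hP),
      MarkovWPI.IsConvergent MarkovWPI.oscSieve (MarkovWPI.markovOp μ P hP),
      MarkovWPI.SatisfiesWPI MarkovWPI.oscSieve
        (MarkovWPI.markovOp μ P hP ∘L ContinuousLinearMap.adjoint (MarkovWPI.markovOp μ P hP)),
      MarkovWPI.IsConvergent MarkovWPI.oscSieve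
        (ContinuousLinearMap.adjoint (MarkovWPI.markovOp μ P hP))] := by
  have hc := MarkovWPI.markovOp_apply_le_norm hP
  have hc' := MarkovWPI.norm_adjoint_apply_le hc
  tfae_have 1 → 2 := MarkovWPI.SatisfiesWPI.adjoint_comp_markovOp hP hPH
  tfae_have 2 → 3 := MarkovWPI.SatisfiesWPI.isConvergent hc
    (fun f h0 => (MarkovWPI.integral_markovOp hP f).trans h0)
    (MarkovWPI.oscSieve_apply_le (MarkovWPI.markovOp_ae_le hP))
    (fun _ => MarkovWPI.norm_sq_le_oscSieve)
  tfae_have 3 → 1 := MarkovWPI.IsConvergent.satisfiesWPI hc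
    (fun _ => MarkovWPI.eq_zero_of_oscSieve_eq_zero)
  tfae_have 1 → 4 := fun h => MarkovWPI.SatisfiesWPI.markovOp_comp_adjoint hP hPH
    (MarkovWPI.satisfiesWPI_adjoint_iff.2 h)
  tfae_have 4 → 5 := fun h => MarkovWPI.SatisfiesWPI.isConvergent hc'
    (fun f h0 => (MarkovWPI.integral_adjoint_markovOp hP f).trans h0)
    (MarkovWPI.oscSieve_apply_le (MarkovWPI.adjoint_markovOp_ae_le hP))
    (fun _ => MarkovWPI.norm_sq_le_oscSieve)
    (by rwa [ContinuousLinearMap.adjoint_adjoint])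
  tfae_have 5 → 1 := fun h => MarkovWPI.satisfiesWPI_adjoint_iff.1
    (MarkovWPI.IsConvergent.satisfiesWPI hc'
      (fun _ => MarkovWPI.eq_zero_of_oscSieve_eq_zero) h)
  tfae_finish
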